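/- Let $p$ be a prime, $q=p^e$, and let $A=\mathbb{Z}_{n_1}\times\cdots\times\mathbb{Z}_{n_h}$ (with all $n_\ell\ge 1$) have exponent $N$ with $(N,q)=1$. Let $m=\mathrm{ord}_N(q)$ be the multiplicative order of $q$ modulo $N$, and for each $\ell$ let $\gamma_\ell\in\mathbb{F}_{q^m}$ be a primitive $n_\ell$-th root of unity. Let $C$ be an abelian code, i.e. an ideal of the group algebra $\mathbb{F}_q[A]$. The Hamming weight of an element of $\mathbb{F}_q[A]$ is the number of its nonzero coefficients, and for $a\in\mathbb{N}$ let $S_p(a)$ be the sum of the base-$p$ digits of $a$. (i) There are $k\ge 0$ and pairwise distinct $s_i=(s_{i,1},\dots,s_{i,h})\in A$, $1\le i\le k$, such that $C$ is the set of all words $$c(\boldsymbol\alpha)=\Bigl(\mathrm{Tr}_{q^m/q}\Bigl(\sum_{i=1}^k\alpha_i\prod_{\ell=1}^h\gamma_\ell^{s_{i,\ell}j_\ell}\Bigr)\Bigr)_{(j_1,\dots,j_h)\in A},\qquad \boldsymbol\alpha\in\mathbb{F}_{q^m}^k. \tag{$*$}$$ (ii) Suppose $C\ne\{0\}$, and let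 $s_1,\dots,s_k\in A$ be any elements for which $(*)$ describes $C$. Then the $p$-adic valuation of $C$, i.e. the greatest integer $t$ such that $p^t$ divides the Hamming weight of every codeword of $C$, exists and equals $$\min_{\boldsymbol r}\ \frac{1}{p-1}\sum_{i=1}^k S_p(r_i)-e,$$ where the minimum is over all $\boldsymbol r=(r_1,\dots,r_k)\in[0,q^m-1]^k$ with $\boldsymbol r\neq\boldsymbol 0$, $\sum_{i=1}^k r_i\equiv 0\pmod{q-1}$, and $\sum_{i=1}^k r_i s_{i,\ell}\equiv 0\pmod{n_\ell}$ for all $1\le\ell\le h$. -/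

import Mathlib

namespace AbelianCode

/-- The group `ℤ/n₁ × ⋯ × ℤ/n_h`. -/
abbrev Grp {h : ℕ} (n : Fin h → ℕ) : Type := (ℓ : Fin h) → ZMod (n ℓ)

/-- `S_p(a)`: the sum of the base-`p` digits of `a`. -/
def digitSum (p a : ℕ) : ℕ := (Nat.digits p a).sum

/-- The Hamming weight of an element of the group algebra: the number of its nonzero
coefficients. -/
def weight {F A : Type*} [Semiring F] (c : AddMonoidAlgebra F A) : ℕ := c.coeff.support.card

/-- All the Hamming weights of `C` are divisible by `Δ`. -/
def IsDivisible {F A : Type*} [Semiring F] (Δ : ℕ) (C : Set (AddMonoidAlgebra F A)) : Prop :=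
  ∀ c ∈ C, Δ ∣ weight c

/-- `t` is the `p`-adic valuation of the code `C`: the greatest integer such that `C` is
`p ^ t`-divisible. -/
def IsPadicValuation {F A : Type*} [Semiring F] (p : ℕ) (C : Set (AddMonoidAlgebra F A))
    (t : ℕ) : Prop :=
  IsGreatest {u : ℕ | IsDivisible (p ^ u) C} t

/-- `C` is the set of all words `(Tr_{K/F} (∑ i, α i * G i j))_j`, where `α` runs through `K^k`. -/
def IsTraceCodeOf {F K A : Type*} [Field F] [Field K] [Algebra F K] {k : ℕ}
    (C : Set (AddMonoidAlgebra F A)) (G : Matrix (Fin k) A K) : Prop :=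
  ∀ c : AddMonoidAlgebra F A,
    c ∈ C ↔ ∃ α : Fin k → K, ∀ j : A, c.coeff j = Algebra.trace F K (∑ i, α i * G i j)

/-- The matrix `(∏ ℓ, γ_ℓ ^ (s_{i,ℓ} j_ℓ))` with rows `i` and columns `j ∈ ℤ/n₁ × ⋯ × ℤ/n_h`. -/
def expMatrix {K : Type*} [Field K] {h k : ℕ} {n : Fin h → ℕ} (γ : Fin h → K)
    (s : Fin k → Grp n) : Matrix (Fin k) (Grp n) K :=
  fun i j => ∏ ℓ, γ ℓ ^ ((s i ℓ).val * (j ℓ).val)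

/-- The feasible set of the minimization problem: nonzero `r ∈ [0, Q - 1]^k` (with `Q = q ^ m`)
such that `|r| ≡ 0 mod (q - 1)` and `∑ i, r_i s_{i,ℓ} ≡ 0 mod n_ℓ` for every `ℓ`. -/
def feasible {h k : ℕ} {n : Fin h → ℕ} (q Q : ℕ) (s : Fin k → Grp n) : Set (Fin k → ℕ) :=
  {r | (∀ i, r i ≤ Q - 1) ∧ 0 < ∑ i, r i ∧ ∑ i, r i ≡ 0 [MOD (q - 1)] ∧
    ∀ ℓ, ∑ i, r i * (s i ℓ).val ≡ 0 [MOD n ℓ]}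

/-- The objective function `(1 / (p - 1)) ∑ i, S_p(r_i) - e`. -/
def objective {k : ℕ} (p e : ℕ) (r : Fin k → ℕ) : ℚ :=
  1 / ((p : ℚ) - 1) * ((∑ i, digitSum p (r i) : ℕ) : ℚ) - (e : ℚ)

end AbelianCode

/-! Write Q = q^m and let T : K → W(K) be the Teichmüller map. Up to the unit (Q-1)^k, every
function K^k → W(K) is a combination of the monomials ∏ T(a_i)^{r_i}, 0 ≤ r_i ≤ Q-1, whose
coefficients are computed integrally by a dual kernel (`kern`, `coef`). Expand the indicator of Tr(∑
a_i) ≠ 0 this way, put a_i = α_i G_ij and sum over positions j. Orthogonality of characters keeps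
exactly the monomials with ∑ r_i s_i = 0, multiplied by the unit ∏ n_ℓ. As the expansion is
invertible, the valuation of the code is the least valuation of the surviving coefficients.

The coefficient at r vanishes if r = 0 or q-1 does not divide ∑ r_i; otherwise its valuation is
exactly ∑ S_p(r_i)/(p-1) - e. For the lower bound (`pow_dvd_coef_traceInd`), the indicator is
congruent modulo p^{L+1} to the p^L(q-1)-th power of a sum of monomials, and Legendre's formula
controls the multinomial coefficients. For sharpness (`not_pow_succ_dvd_coef_traceInd`), q times the
coefficient is a unit times a product of Gauss sums. The products for r and for Q-1-r multiply to a
unit times Q^k, and the two lower bounds already account for this whole power of p, so both are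
equalities. This replaces Stickelberger's theorem.

The trace description (`exists_isTraceCodeOf`) is Fourier inversion: an ideal is determined by the
characters on which the transform of some codeword does not vanish. -/

namespace AbelianCode

/-! ### Base-p digit sums and Legendre's formula. -/

section Digits

variable {p : ℕ}

lemma digitSum_zero : digitSum p 0 = 0 := by simp [digitSum]

lemma digitSum_eq_mod_add_div (hp : 1 < p) (n : ℕ) :
    digitSum p n = n % p + digitSum p (n / p) := by
  rcases Nat.eq_zero_or_pos n with rfl | hn
  · simp [digitSum]
  · simp [digitSum, Nat.digits_def' hp hn]

lemma digitSum_mul_add (hp : 1 < p) (a : ℕ) {d : ℕ} (hd : d < p) :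
    digitSum p (p * a + d) = d + digitSum p a := by
  rw [digitSum_eq_mod_add_div hp, Nat.mul_add_mod, Nat.mod_eq_of_lt hd,
    Nat.mul_add_div (by omega), Nat.div_eq_of_lt hd, add_zero]

lemma digitSum_pow_mul (hp : 1 < p) (L a : ℕ) : digitSum p (p ^ L * a) = digitSum p a := by
  induction L with
  | zero => simp
  | succ L ih =>
    have := digitSum_mul_add hp (p ^ L * a) (d := 0) (by omega)
    rw [pow_succ', mul_assoc]
    simpa [ih] using this

/-- Adding a multiple of `p ^ L` to a number with at most `L` digits causes no carry. -/
lemma digitSum_pow_mul_add (hp : 1 < p) (L a : ℕ) {v : ℕ} (hv : v < p ^ L) :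
    digitSum p (p ^ L * a + v) = digitSum p a + digitSum p v := by
  induction L generalizing v with
  | zero =>
    obtain rfl : v = 0 := by simpa using hv
    simp [digitSum_zero]
  | succ L ih =>
    have hv' : v / p < p ^ L := Nat.div_lt_of_lt_mul (by rwa [← pow_succ'])
    have hd : v % p < p := Nat.mod_lt _ (by omega)
    have h1 : p ^ (L + 1) * a + v = p * (p ^ L * a + v / p) + v % p := by
      conv_lhs => rw [← Nat.div_add_mod v p]
      ring
    rw [h1, digitSum_mul_add hp _ hd, ih hv', digitSum_eq_mod_add_div hp v]
    ring

/-- All digits of p^L - 1 equal p - 1, so the subtraction never borrows and digits in the same place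
add up to p - 1. -/
lemma digitSum_add_digitSum_compl (hp : 1 < p) (L : ℕ) {r : ℕ} (hr : r ≤ p ^ L - 1) :
    digitSum p r + digitSum p (p ^ L - 1 - r) = L * (p - 1) := by
  induction L generalizing r with
  | zero =>
    obtain rfl : r = 0 := by simpa using hr
    simp [digitSum_zero]
  | succ L ih =>
    have hpos : 0 < p ^ L := by positivity
    have hpos' : 0 < p ^ (L + 1) := by positivity
    have hlt : r / p < p ^ L := Nat.div_lt_of_lt_mul (by rw [← pow_succ']; omega)
    have hd : r % p < p := Nat.mod_lt _ (by omega)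
    have h1 : p ^ (L + 1) - 1 - r = p * (p ^ L - 1 - r / p) + (p - 1 - r % p) := by
      have h2 := Nat.div_add_mod r p
      have h3 : p * (p ^ L - 1 - r / p) + p * (r / p) + p = p ^ (L + 1) := by
        rw [← mul_add, ← Nat.mul_succ, pow_succ']
        congr 1
        omega
      omega
    rw [h1, digitSum_mul_add hp _ (by omega), digitSum_eq_mod_add_div hp r]
    have := ih (r := r / p) (by omega)
    rw [Nat.succ_mul]
    omega

lemma digitSum_pow_sub_one (hp : 1 < p) (L : ℕ) : digitSum p (p ^ L - 1) = L * (p - 1) := by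
  simpa [digitSum_zero] using digitSum_add_digitSum_compl hp L (Nat.zero_le _)

/-- Legendre's formula. -/
lemma sub_one_mul_factorization_factorial_add_digitSum [hp : Fact p.Prime] (n : ℕ) :
    (p - 1) * (n.factorial).factorization p + digitSum p n = n := by
  rw [Nat.factorization_def _ hp.out, sub_one_mul_padicValNat_factorial]
  exact Nat.sub_add_cancel (Nat.digit_sum_le p n)

lemma digitSum_modEq [Fact p.Prime] (n : ℕ) : digitSum p n ≡ n [MOD p - 1] := by
  conv_rhs => rw [← sub_one_mul_factorization_factorial_add_digitSum (p := p) n]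
  simp [Nat.ModEq]

/-- Legendre's formula for multinomial coefficients. -/
lemma sub_one_mul_factorization_multinomial [hp : Fact p.Prime] {ι : Type*} (s : Finset ι)
    (f : ι → ℕ) :
    (p - 1) * (Nat.multinomial s f).factorization p + digitSum p (∑ i ∈ s, f i) =
      ∑ i ∈ s, digitSum p (f i) := by
  have leg := sub_one_mul_factorization_factorial_add_digitSum (p := p)
  have h1 := congrArg (fun n : ℕ => n.factorization p) (Nat.multinomial_spec s f)
  rw [Nat.factorization_mul (Finset.prod_ne_zero_iff.2 fun i _ => Nat.factorial_ne_zero _)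
    (Nat.multinomial_pos s f).ne', Finsupp.add_apply, Nat.factorization_prod_apply
    (fun i _ => Nat.factorial_ne_zero _)] at h1
  have h2 := leg (∑ i ∈ s, f i)
  have h3 : ∑ i ∈ s, ((p - 1) * ((f i).factorial).factorization p + digitSum p (f i)) =
    ∑ i ∈ s, f i := Finset.sum_congr rfl fun i _ => leg (f i)
  rw [Finset.sum_add_distrib, ← Finset.mul_sum] at h3
  rw [← h1, mul_add] at h2
  omega

lemma digitSum_sum_le [Fact p.Prime] {ι : Type*} (s : Finset ι) (f : ι → ℕ) :
    digitSum p (∑ i ∈ s, f i) ≤ ∑ i ∈ s, digitSum p (f i) := by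
  rw [← sub_one_mul_factorization_multinomial s f]
  exact Nat.le_add_left _ _

lemma digitSum_add_le [Fact p.Prime] (a b : ℕ) :
    digitSum p (a + b) ≤ digitSum p a + digitSum p b := by
  simpa using digitSum_sum_le (p := p) Finset.univ ![a, b]

/-- Among the positive members of a residue class modulo `p ^ L - 1`, the least one has the least
digit sum. -/
lemma digitSum_le_of_modEq [hp : Fact p.Prime] {L : ℕ} (hL : 0 < L) {r n : ℕ}
    (hr0 : 0 < r) (hr : r ≤ p ^ L - 1) (hn : 0 < n) (h : n ≡ r [MOD p ^ L - 1]) :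
    digitSum p r ≤ digitSum p n := by
  induction n using Nat.strong_induction_on with
  | _ n ih =>
    have hQ : 1 < p ^ L := Nat.one_lt_pow hL.ne' hp.out.one_lt
    rcases Nat.lt_or_ge n (p ^ L) with hlt | hge
    · have : n = r := by
        rcases le_total n r with hle | hle
        · have hd := (Nat.modEq_iff_dvd' hle).1 h
          rcases Nat.eq_zero_or_pos (r - n) with h0 | h0
          · omega
          · have := Nat.le_of_dvd h0 hd
            omega
        · have hd := (Nat.modEq_iff_dvd' hle).1 h.symm
          rcases Nat.eq_zero_or_pos (n - r) with h0 | h0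
          · omega
          · have := Nat.le_of_dvd h0 hd
            omega
      rw [this]
    · have hdm := Nat.div_add_mod n (p ^ L)
      have hv : n % p ^ L < p ^ L := Nat.mod_lt _ (by omega)
      have hu : 0 < n / p ^ L := Nat.div_pos hge (by omega)
      generalize n / p ^ L = u at *
      generalize n % p ^ L = v at *
      subst hdm
      -- Since p^L ≡ 1, replacing p^L u + v by u + v stays in the residue class, and by
      -- subadditivity does not raise the digit sum.
      have key : p ^ L * u + v = (p ^ L - 1) * u + (u + v) := by
        rw [← add_assoc, ← Nat.succ_mul, Nat.succ_eq_add_one, Nat.sub_add_cancel hQ.le]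
      have hcong : u + v ≡ r [MOD p ^ L - 1] := by
        refine Nat.ModEq.trans ?_ h
        rw [key, Nat.ModEq, Nat.mul_add_mod]
      have hlt : u + v < p ^ L * u + v := by
        rw [key]
        have : 0 < (p ^ L - 1) * u := Nat.mul_pos (by omega) hu
        omega
      refine (ih _ hlt (by omega) hcong).trans ?_
      rw [digitSum_pow_mul_add hp.out.one_lt _ _ hv]
      exact digitSum_add_le _ _

end Digits

/-! ### Expansion of functions on K^ι in multiplicative monomials. -/

section Kernel

set_option linter.unusedSectionVars false

variable {K R : Type*} [Field K] [Fintype K] [DecidableEq K] [CommRing R]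

lemma sum_eq_zero_add_sum_units {M : Type*} [AddCommMonoid M] (g : K → M) :
    ∑ a, g a = g 0 + ∑ u : Kˣ, g u := by
  rw [← Finset.add_sum_erase Finset.univ g (Finset.mem_univ 0)]
  congr 1
  symm
  refine Finset.sum_bij (fun u _ => (u : K)) (by simp) (by simp [Units.ext_iff]) ?_ (by simp)
  intro b hb
  exact ⟨Units.mk0 b (by simpa using hb), by simp, rfl⟩

lemma sum_units_pow [IsDomain R] (T : K →*₀ R) (hT : Function.Injective T) (n : ℕ) :
    ∑ u : Kˣ, T u ^ n =
      if Fintype.card K - 1 ∣ n then ((Fintype.card K : R) - 1) else 0 := by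
  classical
  let f : Kˣ →* R := (powMonoidHom n).comp ((T : K →* R).comp (Units.coeHom K))
  have h1 := sum_hom_units f
  have h2 : f = 1 ↔ Fintype.card K - 1 ∣ n := by
    rw [← FiniteField.forall_pow_eq_one_iff, MonoidHom.ext_iff]
    refine forall_congr' fun u => ?_
    rw [show f u = T ((u ^ n : Kˣ) : K) by simp [f], MonoidHom.one_apply, ← map_one T,
      hT.eq_iff, Units.val_eq_one]
  have h3 : ((Fintype.card Kˣ : ℕ) : R) = (Fintype.card K : R) - 1 := by
    rw [Fintype.card_units, Nat.cast_sub Fintype.one_lt_card.le, Nat.cast_one]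
  rw [← h3]
  refine h1.trans ?_
  by_cases h : f = 1
  · simp [h, h2.1 h]
  · simp [h, mt h2.2 h]

/-- The kernel dual to the monomials `a ↦ T a ^ r`, `0 ≤ r ≤ |K| - 1`. -/
def kern (T : K →*₀ R) (r : ℕ) (a : K) : R :=
  -- The monomials with exponents 0 and |K| - 1 differ only at 0, so the value of the kernel at 0
  -- has to separate them.
  if a = 0 then
    ((Fintype.card K : R) - 1) *
      ((if r = 0 then 1 else 0) - (if r = Fintype.card K - 1 then 1 else 0))
  else if r = 0 then 0 else T a ^ (Fintype.card K - 1 - r)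

lemma map_pow_card_sub_one (T : K →*₀ R) {a : K} (ha : a ≠ 0) :
    T a ^ (Fintype.card K - 1) = 1 := by
  rw [← map_pow, FiniteField.pow_card_sub_one_eq_one a ha, map_one]

lemma sum_kern_mul (T : K →*₀ R) (r : ℕ) (g : K → R) :
    ∑ a, kern T r a * g a = ((Fintype.card K : R) - 1) *
      ((if r = 0 then 1 else 0) - (if r = Fintype.card K - 1 then 1 else 0)) * g 0 +
      if r = 0 then 0 else ∑ u : Kˣ, T u ^ (Fintype.card K - 1 - r) * g u := by
  rw [sum_eq_zero_add_sum_units]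
  split_ifs <;> simp_all [kern]

/-- As a function on K, T^n depends only on n modulo |K| - 1 and on whether n = 0; the condition
says that r is the reduced exponent of n. -/
lemma sum_kern_mul_pow [IsDomain R] (T : K →*₀ R) (hT : Function.Injective T) {r : ℕ}
    (hr : r ≤ Fintype.card K - 1) (n : ℕ) :
    ∑ a, kern T r a * T a ^ n =
      if (r = 0 ↔ n = 0) ∧ n ≡ r [MOD Fintype.card K - 1] then (Fintype.card K : R) - 1
      else 0 := by
  have hQ : 1 < Fintype.card K := Fintype.one_lt_card
  rw [sum_kern_mul]
  rcases Nat.eq_zero_or_pos r with rfl | hr0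
  · have : ¬ (0 = Fintype.card K - 1) := by omega
    rcases Nat.eq_zero_or_pos n with rfl | hn
    · simp [this, Nat.ModEq.refl]
    · simp [this, hn.ne']
  · have h1 : Fintype.card K - 1 ∣ Fintype.card K - 1 - r + n ↔
        n ≡ r [MOD Fintype.card K - 1] := by
      rw [← Nat.modEq_zero_iff_dvd]
      constructor
      · intro h
        have h2 := h.add_right r
        rw [show Fintype.card K - 1 - r + n + r = n + (Fintype.card K - 1) by omega, zero_add] at h2
        exact (by simp [Nat.ModEq] : n ≡ n + (Fintype.card K - 1) [MOD _]).trans h2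
      · intro h
        refine (h.add_left _).trans ?_
        rw [Nat.sub_add_cancel hr]
        simp [Nat.ModEq]
    simp only [hr0.ne', if_false, ← pow_add, sum_units_pow T hT, h1, false_iff]
    rcases Nat.eq_zero_or_pos n with rfl | hn
    · have h2 : 0 ≡ r [MOD Fintype.card K - 1] ↔ r = Fintype.card K - 1 := by
        refine ⟨fun h => ?_, fun h => by rw [h]; simp [Nat.ModEq]⟩
        have := Nat.le_of_dvd hr0 ((Nat.modEq_zero_iff_dvd).1 h.symm)
        omega
      rw [if_congr h2 rfl rfl]
      by_cases h3 : r = Fintype.card K - 1 <;> simp [h3]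
    · simp [hn.ne']

lemma sum_range_kern_mul_pow [IsDomain R] (T : K →*₀ R) (hT : Function.Injective T) (a x : K) :
    ∑ r ∈ Finset.range (Fintype.card K), kern T r a * T x ^ r =
      if x = a then (Fintype.card K : R) - 1 else 0 := by
  have hQ : 1 < Fintype.card K := Fintype.one_lt_card
  by_cases ha : a = 0
  · subst ha
    have hmem : Fintype.card K - 1 < Fintype.card K := by omega
    have h0 : 0 < Fintype.card K := by omega
    simp only [kern, if_true, mul_assoc, ← Finset.mul_sum, sub_mul, ite_mul, one_mul, zero_mul,
      Finset.sum_sub_distrib, Finset.sum_ite_eq', Finset.mem_range, hmem, h0, pow_zero]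
    by_cases hx : x = 0
    · simp [hx, show Fintype.card K - 1 ≠ 0 by omega]
    · simp [hx, map_pow_card_sub_one T hx]
  · obtain ⟨n, hn⟩ : ∃ n, Fintype.card K = n + 1 := ⟨Fintype.card K - 1, by omega⟩
    have h1 : ∑ r ∈ Finset.range (Fintype.card K), kern T r a * T x ^ r =
        T x * ∑ r ∈ Finset.range n, T x ^ r * T a ^ (n - 1 - r) := by
      rw [hn, Finset.sum_range_succ', Finset.mul_sum]
      simp only [kern, ha, hn, if_false, Nat.add_eq_zero_iff, one_ne_zero, and_false, if_true,
        zero_mul, add_zero]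
      refine Finset.sum_congr rfl fun r _ => ?_
      rw [show n + 1 - 1 - (r + 1) = n - 1 - r by omega]
      ring
    rw [h1]
    have hcard : (Fintype.card K : R) - 1 = n := by simp [hn]
    have hpow {y : K} (hy : y ≠ 0) : T y ^ n = 1 := by
      simpa [hn] using map_pow_card_sub_one T hy
    by_cases hxa : x = a
    · subst hxa
      rw [if_pos rfl, hcard, Finset.mul_sum, Finset.sum_congr rfl (g := fun _ => (1 : R))]
      · simp
      · intro r hr
        rw [Finset.mem_range] at hr
        rw [← pow_add, ← pow_succ', show r + (n - 1 - r) + 1 = n by omega, hpow ha]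
    · rw [if_neg hxa]
      by_cases hx : x = 0
      · simp [hx]
      -- The geometric sum times T x - T a is T x^n - T a^n = 1 - 1 = 0.
      · have h2 := (Commute.all (T x) (T a)).geom_sum₂_mul n
        rw [hpow hx, hpow ha, sub_self, mul_eq_zero] at h2
        rcases h2 with h2 | h2
        · rw [h2, mul_zero]
        · exact absurd (hT (sub_eq_zero.1 h2)) hxa

lemma kern_div (T : K →*₀ R) {r : ℕ} (hr : r ≤ Fintype.card K - 1) (a : K) {y : K} (hy : y ≠ 0) :
    kern T r (a / y) = T y ^ r * kern T r a := by
  by_cases ha : a = 0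
  · subst ha
    rcases Nat.eq_zero_or_pos r with rfl | hr0
    · simp
    · by_cases hr1 : r = Fintype.card K - 1
      · simp [hr1, map_pow_card_sub_one T hy]
      · simp [kern, hr0.ne', hr1]
  · rcases Nat.eq_zero_or_pos r with rfl | hr0
    · simp [kern, ha, hy]
    · have h1 : T (a / y) * T y = T a := by rw [← map_mul, div_mul_cancel₀ _ hy]
      have h2 := map_pow_card_sub_one T hy
      simp only [kern, div_eq_zero_iff, ha, hy, or_self, if_false, hr0.ne']
      rw [← h1, mul_pow, mul_left_comm, ← pow_add, Nat.add_sub_cancel' hr, h2, mul_one]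

lemma map_kern {R' : Type*} [CommRing R'] (φ : R →+* R') (T : K →*₀ R)
    (r : ℕ) (a : K) :
    φ (kern T r a) = kern (φ.toMonoidWithZeroHom.comp T) r a := by
  simp only [kern]
  split_ifs <;> simp

variable {ι : Type*} [Fintype ι] [DecidableEq ι]

/-- `(|K| - 1) ^ |ι|` times the coefficient of the monomial `a ↦ ∏ i, T (a i) ^ r i` in the
expansion of `f`. -/
def coef (T : K →*₀ R) (f : (ι → K) → R) (r : ι → ℕ) : R :=
  ∑ a, f a * ∏ i, kern T (r i) (a i)

lemma sum_coef_mul_prod_pow [IsDomain R] (T : K →*₀ R) (hT : Function.Injective T) (f : (ι → K) → R)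
    (x : ι → K) :
    ∑ r ∈ Fintype.piFinset (fun _ : ι => Finset.range (Fintype.card K)),
      coef T f r * ∏ i, T (x i) ^ r i = ((Fintype.card K : R) - 1) ^ Fintype.card ι * f x := by
  simp only [coef, Finset.sum_mul]
  rw [Finset.sum_comm]
  have h (a : ι → K) : ∑ r ∈ Fintype.piFinset (fun _ : ι => Finset.range (Fintype.card K)),
      (f a * ∏ i, kern T (r i) (a i)) * ∏ i, T (x i) ^ r i =
      f a * if x = a then ((Fintype.card K : R) - 1) ^ Fintype.card ι else 0 := by
    simp only [mul_assoc, ← Finset.mul_sum, ← Finset.prod_mul_distrib]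
    congr 1
    rw [← Finset.prod_univ_sum (fun _ : ι => Finset.range (Fintype.card K))
      (fun i r => kern T r (a i) * T (x i) ^ r)]
    simp only [sum_range_kern_mul_pow T hT]
    by_cases hxa : x = a
    · simp [hxa]
    · obtain ⟨i, hi⟩ := Function.ne_iff.1 hxa
      rw [if_neg hxa]
      exact Finset.prod_eq_zero (Finset.mem_univ i) (if_neg hi)
  simp only [h]
  simp [mul_comm]

lemma coef_prod (T : K →*₀ R) (g : ι → K → R) (r : ι → ℕ) :
    coef T (fun a => ∏ i, g i (a i)) r = ∏ i, ∑ a, kern T (r i) a * g i a := by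
  rw [Finset.prod_univ_sum, Fintype.piFinset_univ]
  simp only [coef, ← Finset.prod_mul_distrib, mul_comm]

lemma coef_prod_pow [IsDomain R] (T : K →*₀ R) (hT : Function.Injective T) {r : ι → ℕ}
    (hr : ∀ i, r i ≤ Fintype.card K - 1) (n : ι → ℕ) :
    coef T (fun a => ∏ i, T (a i) ^ n i) r =
      if ∀ i, (r i = 0 ↔ n i = 0) ∧ n i ≡ r i [MOD Fintype.card K - 1] then
        ((Fintype.card K : R) - 1) ^ Fintype.card ι else 0 := by
  rw [coef_prod T (fun i a => T a ^ n i)]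
  simp only [sum_kern_mul_pow T hT (hr _)]
  split_ifs with h
  · simp [h]
  · push Not at h
    obtain ⟨i, hi⟩ := h
    refine Finset.prod_eq_zero (Finset.mem_univ i) (if_neg ?_)
    exact fun h => hi h.1 h.2

lemma coef_add (T : K →*₀ R) (f g : (ι → K) → R) (r : ι → ℕ) :
    coef T (fun a => f a + g a) r = coef T f r + coef T g r := by
  simp [coef, add_mul, Finset.sum_add_distrib]

lemma coef_const_mul (T : K →*₀ R) (c : R) (f : (ι → K) → R) (r : ι → ℕ) :
    coef T (fun a => c * f a) r = c * coef T f r := by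
  simp [coef, mul_assoc, Finset.mul_sum]

lemma coef_sum {κ : Type*} (s : Finset κ) (T : K →*₀ R) (f : κ → (ι → K) → R) (r : ι → ℕ) :
    coef T (fun a => ∑ j ∈ s, f j a) r = ∑ j ∈ s, coef T (f j) r := by
  simp only [coef, Finset.sum_mul]
  exact Finset.sum_comm

/-- No division occurs in `coef`, so divisibility of all values passes to all coefficients. -/
lemma dvd_coef (T : K →*₀ R) {d : R} {f : (ι → K) → R} (hf : ∀ a, d ∣ f a) (r : ι → ℕ) :
    d ∣ coef T f r :=
  Finset.dvd_sum fun a _ => (hf a).mul_right _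

end Kernel

/-! ### Coefficients of the trace indicator as products of Gauss sums. -/

section Gauss

set_option linter.unusedSectionVars false

lemma addChar_map_sum {A R ι : Type*} [AddCommMonoid A] [CommMonoid R] (ψ : AddChar A R)
    (s : Finset ι) (g : ι → A) : ψ (∑ i ∈ s, g i) = ∏ i ∈ s, ψ (g i) := by
  classical
  induction s using Finset.induction_on with
  | empty => simp
  | insert i s hi ih => rw [Finset.sum_insert hi, Finset.prod_insert hi, AddChar.map_add_eq_mul, ih]

variable {K R : Type*} [Field K] [Fintype K] [DecidableEq K] [CommRing R] [IsDomain R]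

/-- The coefficient of `a ↦ T a ^ r` in the expansion of the additive character `Ψ`, multiplied
by `|K| - 1`. -/
def gaussCoef (T : K →*₀ R) (Ψ : AddChar K R) (r : ℕ) : R := ∑ a, kern T r a * Ψ a

/-- For y ≠ 0 substitute a ↦ a / y and use the homogeneity of the kernel (`kern_div`); y = 0 is
orthogonality. -/
lemma sum_kern_mul_addChar (T : K →*₀ R) (hT : Function.Injective T) (Ψ : AddChar K R) {r : ℕ}
    (hr : r ≤ Fintype.card K - 1) (y : K) :
    ∑ a, kern T r a * Ψ (y * a) = T y ^ r * gaussCoef T Ψ r := by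
  have hQ : 1 < Fintype.card K := Fintype.one_lt_card
  by_cases hy : y = 0
  · subst hy
    have h1 := sum_kern_mul_pow T hT hr 0
    simp only [pow_zero, mul_one] at h1
    simp only [zero_mul, AddChar.map_zero_eq_one, mul_one, h1, map_zero]
    rcases Nat.eq_zero_or_pos r with rfl | hr0
    · have : ¬ (0 = Fintype.card K - 1) := by omega
      simp [Nat.ModEq.refl, gaussCoef, sum_kern_mul, this]
    · simp [hr0.ne']
  · rw [gaussCoef, Finset.mul_sum]
    refine Fintype.sum_equiv (Equiv.mulLeft₀ y hy) _ _ fun a => ?_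
    rw [← mul_assoc, ← kern_div T hr _ hy]
    simp [hy]

lemma gaussCoef_zero (T : K →*₀ R) (Ψ : AddChar K R) :
    gaussCoef T Ψ 0 = (Fintype.card K : R) - 1 := by
  have hQ : 1 < Fintype.card K := Fintype.one_lt_card
  have : ¬ (0 = Fintype.card K - 1) := by omega
  simp [gaussCoef, sum_kern_mul, this]

lemma gaussCoef_card_sub_one (T : K →*₀ R) {Ψ : AddChar K R} (hΨ : Ψ ≠ 1) :
    gaussCoef T Ψ (Fintype.card K - 1) = -(Fintype.card K : R) := by
  have hQ : 1 < Fintype.card K := Fintype.one_lt_card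
  have h0 : Fintype.card K - 1 ≠ 0 := by omega
  have h1 := AddChar.sum_eq_zero_of_ne_one hΨ
  rw [sum_eq_zero_add_sum_units, AddChar.map_zero_eq_one] at h1
  simp only [gaussCoef, sum_kern_mul, h0, if_false, if_true, AddChar.map_zero_eq_one,
    Nat.sub_self, pow_zero, one_mul]
  linear_combination h1

/-- Strictly between the extreme exponents, `gaussCoef` is the Gauss sum of the nontrivial character
T^(|K|-1-r), and the claim is the classical product g(χ, Ψ) g(χ⁻¹, Ψ⁻¹) = |K|. -/
lemma gaussCoef_mul_gaussCoef_of_lt (T : K →*₀ R) (hT : Function.Injective T) {Ψ : AddChar K R}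
    (hΨ : Ψ ≠ 1) {r : ℕ} (hr0 : 0 < r) (hr : r < Fintype.card K - 1) :
    gaussCoef T Ψ r * gaussCoef T Ψ⁻¹ (Fintype.card K - 1 - r) = Fintype.card K := by
  have hz : Fintype.card K - 1 - r ≠ 0 := by omega
  let χ : MulChar K R :=
    { toMonoidHom := (powMonoidHom (Fintype.card K - 1 - r)).comp (T : K →* R)
      map_nonunit' := fun a ha => by
        obtain rfl : a = 0 := by simpa using ha
        simp [hz] }
  have hχ (a : K) : χ a = T a ^ (Fintype.card K - 1 - r) := rfl
  have hχi (a : K) : χ⁻¹ a = T a ^ r := by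
    rw [MulChar.inv_apply', hχ]
    by_cases ha : a = 0
    · simp [ha, hz, hr0.ne']
    · have h1 : T a⁻¹ * T a = 1 := by rw [← map_mul, inv_mul_cancel₀ ha, map_one]
      have h2 := map_pow_card_sub_one T ha
      calc T a⁻¹ ^ (Fintype.card K - 1 - r)
          = T a⁻¹ ^ (Fintype.card K - 1 - r) * T a ^ (Fintype.card K - 1 - r + r) := by
            rw [Nat.sub_add_cancel hr.le, h2, mul_one]
        _ = (T a⁻¹ * T a) ^ (Fintype.card K - 1 - r) * T a ^ r := by rw [pow_add, mul_pow]; ring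
        _ = T a ^ r := by rw [h1, one_pow, one_mul]
  have hχ1 : χ ≠ 1 := by
    intro h
    have h2 (u : Kˣ) : T u ^ (Fintype.card K - 1 - r) = 1 := by
      rw [← hχ, h, MulChar.one_apply_coe]
    have h3 : Fintype.card K - 1 ∣ Fintype.card K - 1 - r := by
      rw [← FiniteField.forall_pow_eq_one_iff]
      intro u
      rw [← Units.val_eq_one, ← hT.eq_iff, map_one, ← h2 u, Units.val_pow_eq_pow_val, map_pow]
    have := Nat.le_of_dvd (by omega) h3
    omega
  have h1 := gaussSum_mul_gaussSum_eq_card hχ1 (AddChar.IsPrimitive.of_ne_one hΨ)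
  rw [← h1]
  congr 1
  · simp only [gaussCoef, gaussSum]
    refine Finset.sum_congr rfl fun a _ => ?_
    rw [hχ]
    by_cases ha : a = 0
    · simp [kern, ha, hr0.ne', hr.ne, hz]
    · simp [kern, ha, hr0.ne']
  · simp only [gaussCoef, gaussSum]
    refine Finset.sum_congr rfl fun a _ => ?_
    rw [hχi]
    by_cases ha : a = 0
    · simp [kern, ha, hr0.ne', hz, show Fintype.card K - 1 - r ≠ Fintype.card K - 1 by omega]
    · simp [kern, ha, hz, show Fintype.card K - 1 - (Fintype.card K - 1 - r) = r by omega]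

lemma gaussCoef_mul_gaussCoef (T : K →*₀ R) (hT : Function.Injective T) {Ψ : AddChar K R}
    (hΨ : Ψ ≠ 1) {r : ℕ} (hr : r ≤ Fintype.card K - 1) :
    gaussCoef T Ψ r * gaussCoef T Ψ⁻¹ (Fintype.card K - 1 - r) =
      Fintype.card K * if 0 < r ∧ r < Fintype.card K - 1 then 1 else 1 - (Fintype.card K : R) := by
  have hΨ' : Ψ⁻¹ ≠ 1 := inv_ne_one.2 hΨ
  split_ifs with h
  · rw [gaussCoef_mul_gaussCoef_of_lt T hT hΨ h.1 h.2, mul_one]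
  · rcases Nat.eq_zero_or_pos r with rfl | hr0
    · rw [Nat.sub_zero, gaussCoef_zero, gaussCoef_card_sub_one T hΨ']
      ring
    · obtain rfl : r = Fintype.card K - 1 := by omega
      rw [Nat.sub_self, gaussCoef_zero, gaussCoef_card_sub_one T hΨ]
      ring

variable {F : Type*} [Field F] [Fintype F] [DecidableEq F] [Algebra F K]
variable {ι : Type*} [Fintype ι] [DecidableEq ι]

/-- The indicator function of the vectors `a` with `Tr (∑ i, a i) ≠ 0`. -/
noncomputable def traceInd (F K R ι : Type*) [Field F] [Field K] [Algebra F K] [DecidableEq F]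
    [CommRing R] [Fintype ι] (a : ι → K) : R :=
  if Algebra.trace F K (∑ i, a i) = 0 then 0 else 1

/-- The additive character `ψ ∘ Tr` of `K`. -/
noncomputable def traceChar (K : Type*) [Field K] [Algebra F K] (ψ : AddChar F R) : AddChar K R :=
  ψ.compAddMonoidHom (Algebra.trace F K).toAddMonoidHom

lemma traceChar_inv (ψ : AddChar F R) : traceChar K ψ⁻¹ = (traceChar K ψ)⁻¹ := by
  ext a
  simp [traceChar, AddChar.inv_apply]

lemma traceChar_ne_one {ψ : AddChar F R} (hψ : ψ ≠ 1) : traceChar K ψ ≠ 1 := by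
  obtain ⟨y, hy⟩ := AddChar.ne_one_iff.1 hψ
  have : FiniteDimensional F K := Module.Finite.of_finite
  obtain ⟨a, rfl⟩ := Algebra.trace_surjective F K y
  exact AddChar.ne_one_iff.2 ⟨a, hy⟩

/-- The sum of ψ(y t) over y in F is |F| when t = 0 and 0 otherwise. -/
lemma card_mul_traceInd {ψ : AddChar F R} (hψ : ψ ≠ 1) (a : ι → K) :
    (Fintype.card F : R) * traceInd F K R ι a =
      Fintype.card F + (-1) * ∑ y : F, ∏ i, traceChar K ψ (algebraMap F K y * a i) := by
  have h1 (y : F) : ∏ i, traceChar K ψ (algebraMap F K y * a i) =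
      ψ (y * Algebra.trace F K (∑ i, a i)) := by
    rw [← addChar_map_sum, ← Finset.mul_sum, ← Algebra.smul_def, ← smul_eq_mul y, ← map_smul]
    rfl
  simp only [h1, AddChar.sum_mulShift _ (AddChar.IsPrimitive.of_ne_one hψ), traceInd]
  split_ifs <;> simp

/-- The additive character of a sum factors over the coordinates, which gives the Gauss sums; the
remaining sum of T(y)^(∑ r_i) over y in F yields the divisibility condition. -/
lemma card_mul_coef_traceInd (T : K →*₀ R) (hT : Function.Injective T) {ψ : AddChar F R}
    (hψ : ψ ≠ 1) {r : ι → ℕ} (hr : ∀ i, r i ≤ Fintype.card K - 1) :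
    (Fintype.card F : R) * coef T (traceInd F K R ι) r =
      if 0 < ∑ i, r i ∧ Fintype.card F - 1 ∣ ∑ i, r i then
        -((Fintype.card F : R) - 1) * ∏ i, gaussCoef T (traceChar K ψ) (r i)
      else 0 := by
  rw [← coef_const_mul]
  simp only [card_mul_traceInd hψ]
  rw [coef_add, coef_const_mul, coef_sum]
  have h1 : coef T (fun _ : ι → K => (Fintype.card F : R)) r = Fintype.card F *
      if ∑ i, r i = 0 then ((Fintype.card K : R) - 1) ^ Fintype.card ι else 0 := by
    have := coef_const_mul T (Fintype.card F : R) (fun _ : ι → K => 1) r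
    rw [mul_one] at this
    rw [this]
    have h2 := coef_prod_pow T hT hr (fun _ => 0)
    simp only [pow_zero, Finset.prod_const_one] at h2
    rw [h2]
    congr 1
    refine if_congr ?_ rfl rfl
    simp only [iff_true, Finset.sum_eq_zero_iff, Finset.mem_univ, true_imp_iff]
    exact ⟨fun h i => (h i).1, fun h i => ⟨h i, by rw [h i]⟩⟩
  have h2 (y : F) : coef T (fun a : ι → K => ∏ i, traceChar K ψ (algebraMap F K y * a i)) r =
      T (algebraMap F K y) ^ (∑ i, r i) * ∏ i, gaussCoef T (traceChar K ψ) (r i) := by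
    rw [coef_prod T (fun i a => traceChar K ψ (algebraMap F K y * a))]
    simp only [sum_kern_mul_addChar T hT _ (hr _), Finset.prod_mul_distrib,
      Finset.prod_pow_eq_pow_sum]
  have h3 (n : ℕ) : ∑ y : F, T (algebraMap F K y) ^ n =
      0 ^ n + if Fintype.card F - 1 ∣ n then (Fintype.card F : R) - 1 else 0 := by
    have h4 := sum_units_pow (T.comp (algebraMap F K).toMonoidWithZeroHom)
      (hT.comp (algebraMap F K).injective) n
    rw [sum_eq_zero_add_sum_units, ← h4]
    simp
  rw [h1]
  simp only [h2, ← Finset.sum_mul, h3]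
  rcases Nat.eq_zero_or_pos (∑ i, r i) with h0 | h0
  · have h5 (i) : r i = 0 := by simpa using (Finset.sum_eq_zero_iff.1 h0) i
    simp [h5, gaussCoef_zero]
  · by_cases h6 : Fintype.card F - 1 ∣ ∑ i, r i 
    · simp only [h0, h0.ne', h6, if_true, if_false, and_self, zero_pow h0.ne']
      ring
    · simp [h0.ne', h6]

end Gauss

/-! ### Integrality of the objective function. -/

section Exponents

lemma pos_of_card_eq_pow {G : Type*} [Fintype G] [Nontrivial G] {b L : ℕ}
    (hG : Fintype.card G = b ^ L) : 0 < L := by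
  rcases Nat.eq_zero_or_pos L with rfl | h
  · have : 1 < Fintype.card G := Fintype.one_lt_card
    simp [hG] at this
  · exact h

variable {p : ℕ} [hp : Fact p.Prime] {ι : Type*} [Fintype ι]

/-- The objective function is a natural number at every feasible point. -/
lemma exists_sum_digitSum_eq {e : ℕ} (he : 0 < e) {r : ι → ℕ} (h0 : 0 < ∑ i, r i)
    (hd : p ^ e - 1 ∣ ∑ i, r i) : ∃ x, ∑ i, digitSum p (r i) = (p - 1) * (x + e) := by
  have hp1 : 0 < p - 1 := Nat.sub_pos_of_lt hp.out.one_lt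
  have hq : 1 < p ^ e := Nat.one_lt_pow he.ne' hp.out.one_lt
  -- Among positive multiples of p^e - 1, the number p^e - 1 itself has the least digit sum, namely
  -- e(p - 1).
  have h1 : e * (p - 1) ≤ ∑ i, digitSum p (r i) := by
    rw [← digitSum_pow_sub_one hp.out.one_lt]
    refine (digitSum_le_of_modEq he (by omega) le_rfl h0 ?_).trans (digitSum_sum_le _ _)
    exact ((Nat.modEq_zero_iff_dvd).2 hd).trans (by simp [Nat.ModEq])
  have h2 : p - 1 ∣ ∑ i, digitSum p (r i) := by
    rw [← Nat.modEq_zero_iff_dvd]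
    have h3 : ∑ i, digitSum p (r i) ≡ ∑ i, r i [MOD p - 1] := by
      have hs (s : Finset ι) : ∑ i ∈ s, digitSum p (r i) ≡ ∑ i ∈ s, r i [MOD p - 1] := by
        classical
        induction s using Finset.induction_on with
        | empty => rfl
        | insert i s hi ih =>
          rw [Finset.sum_insert hi, Finset.sum_insert hi]
          exact (digitSum_modEq _).add ih
      exact hs _
    refine h3.trans ((Nat.modEq_zero_iff_dvd).2 (dvd_trans ?_ hd))
    simpa using Nat.sub_dvd_pow_sub_pow p 1 e
  obtain ⟨c, hc⟩ := h2
  rw [hc, mul_comm e] at h1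
  have := Nat.le_of_mul_le_mul_left h1 hp1
  exact ⟨c - e, by rw [hc, Nat.sub_add_cancel this]⟩

end Exponents

/-! ### Exact p-adic valuation of the indicator's coefficients. -/

section Witt

set_option linter.unusedSectionVars false

variable {p : ℕ} [hp : Fact p.Prime] {K : Type*} [Field K] [CharP K p]

/-- The Teichmüller map. -/
noncomputable def teich (p : ℕ) [Fact p.Prime] (K : Type*) [Field K] : K →*₀ WittVector p K :=
  { WittVector.teichmuller p with map_zero' := WittVector.teichmuller_zero p }

lemma constantCoeff_teich (a : K) : WittVector.constantCoeff (teich p K a) = a :=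
  WittVector.teichmuller_coeff_zero p a

lemma teich_injective : Function.Injective (teich p K) :=
  Function.LeftInverse.injective constantCoeff_teich

lemma natCast_p_ne_zero : ((p : ℕ) : WittVector p K) ≠ 0 := (WittVector.irreducible p).ne_zero

lemma p_dvd_iff [PerfectRing K p] (x : WittVector p K) :
    (p : WittVector p K) ∣ x ↔ WittVector.constantCoeff x = 0 := by
  constructor
  · rintro ⟨y, rfl⟩
    rw [map_mul, map_natCast, CharP.cast_eq_zero, zero_mul]
  · intro h
    by_cases hx : x = 0
    · simp [hx]
    · obtain ⟨m, b, hb, rfl⟩ := WittVector.exists_eq_pow_p_mul x hx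
      rcases Nat.eq_zero_or_pos m with rfl | hm
      · exact absurd (by simpa using h) hb
      · exact (dvd_pow_self _ hm.ne').mul_right _

lemma pow_dvd_natCast_iff (t n : ℕ) :
    (p : WittVector p K) ^ t ∣ (n : WittVector p K) ↔ p ^ t ∣ n := by
  constructor
  · induction t generalizing n with
    | zero => simp
    | succ t ih =>
      intro h
      have h1 : p ∣ n := by
        obtain ⟨y, hy⟩ := h
        have := congrArg WittVector.constantCoeff hy
        rwa [map_natCast, map_mul, map_pow, map_natCast, CharP.cast_eq_zero K p,
          zero_pow t.succ_ne_zero, zero_mul, CharP.cast_eq_zero_iff K p] at this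
      obtain ⟨n, rfl⟩ := h1
      rw [pow_succ'] at h ⊢
      rw [Nat.cast_mul, mul_dvd_mul_iff_left natCast_p_ne_zero] at h
      exact mul_dvd_mul_left _ (ih n h)
  · rintro ⟨y, rfl⟩
    simp

variable [Fintype K] [DecidableEq K] {F : Type*} [Field F] [Fintype F] [DecidableEq F] [Algebra F K]
variable {ι : Type*} [Fintype ι] [DecidableEq ι]

/-- Approximation of the indicator function by a power of the sum of the conjugates. -/
lemma pow_dvd_pow_sub_traceInd (L : ℕ) (a : ι → K) :
    (p : WittVector p K) ^ (L + 1) ∣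
      (∑ j : ι × Fin (Module.finrank F K), teich p K (a j.1) ^ Fintype.card F ^ (j.2 : ℕ)) ^
        (p ^ L * (Fintype.card F - 1)) - traceInd F K (WittVector p K) ι a := by
  have hq : 1 < Fintype.card F := Fintype.one_lt_card
  set t := Algebra.trace F K (∑ i, a i) with ht
  have h1 : (p : WittVector p K) ∣
      (∑ j : ι × Fin (Module.finrank F K), teich p K (a j.1) ^ Fintype.card F ^ (j.2 : ℕ)) -
        teich p K (algebraMap F K t) := by
    -- Modulo p, Teichmüller lifts reduce to the elements themselves and the sum becomes the sum of
    -- conjugates, which is the trace.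
    rw [p_dvd_iff, map_sub, map_sum, sub_eq_zero, constantCoeff_teich, ht, map_sum, map_sum]
    simp only [map_pow, constantCoeff_teich, FiniteField.algebraMap_trace_eq_sum_pow,
      Fintype.sum_prod_type, Finset.sum_range, Nat.card_eq_fintype_card]
  -- Raising to the power p^L lifts a congruence mod p to one mod p^(L+1); the further power q - 1
  -- turns the lift of t into 0 or 1.
  have h2 := (dvd_sub_pow_of_dvd_sub h1 L).trans
    (sub_dvd_pow_sub_pow _ _ (Fintype.card F - 1))
  rw [← pow_mul, ← pow_mul] at h2
  convert h2 using 2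
  rw [traceInd, ← ht]
  split_ifs with h0
  · rw [h0, map_zero, map_zero, zero_pow]
    exact Nat.mul_ne_zero (pow_ne_zero _ hp.out.ne_zero) (by omega)
  · rw [mul_comm, pow_mul, ← map_pow, ← map_pow (algebraMap F K),
      FiniteField.pow_card_sub_one_eq_one t h0, map_one, map_one, one_pow]

/-- Lower bound for the `p`-adic valuation of the coefficients of the indicator function. -/
lemma pow_dvd_coef_traceInd {e M x : ℕ} (hF : Fintype.card F = p ^ e)
    (hK : Fintype.card K = p ^ M) {r : ι → ℕ} (hr : ∀ i, r i ≤ Fintype.card K - 1)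
    (hx : ∑ i, digitSum p (r i) = (p - 1) * (x + e)) :
    (p : WittVector p K) ^ x ∣ coef (teich p K) (traceInd F K (WittVector p K) ι) r := by
  have hp1 : 0 < p - 1 := Nat.sub_pos_of_lt hp.out.one_lt
  have hM : 0 < M := pos_of_card_eq_pow hK
  set N := p ^ x * (Fintype.card F - 1) with hN
  set z : (ι → K) → WittVector p K := fun a =>
    ∑ j : ι × Fin (Module.finrank F K), teich p K (a j.1) ^ Fintype.card F ^ (j.2 : ℕ) with hz
  have h1 : (p : WittVector p K) ^ x ∣
      coef (teich p K) (fun a => z a ^ N - traceInd F K (WittVector p K) ι a) r :=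
    dvd_coef _ (fun a => (pow_dvd_pow _ x.le_succ).trans (pow_dvd_pow_sub_traceInd x a)) r
  have h2 : (p : WittVector p K) ^ x ∣ coef (teich p K) (fun a => z a ^ N) r := by
    simp only [hz, Finset.sum_pow_eq_sum_piAntidiag]
    rw [coef_sum]
    refine Finset.dvd_sum fun k hk => ?_
    rw [coef_const_mul]
    have h3 (a : ι → K) : ∏ j : ι × Fin (Module.finrank F K),
        (teich p K (a j.1) ^ Fintype.card F ^ (j.2 : ℕ)) ^ k j =
        ∏ i, teich p K (a i) ^ (∑ b : Fin (Module.finrank F K),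
          Fintype.card F ^ (b : ℕ) * k (i, b)) := by
      rw [Fintype.prod_prod_type]
      simp only [← pow_mul, Finset.prod_pow_eq_pow_sum]
    simp only [h3]
    rw [coef_prod_pow _ teich_injective hr]
    split_ifs with h4
    · refine Dvd.dvd.mul_right ?_ _
      rw [pow_dvd_natCast_iff, hp.out.pow_dvd_iff_le_factorization (Nat.multinomial_pos _ _).ne']
      have h5 := sub_one_mul_factorization_multinomial (p := p) Finset.univ k
      have h6 : ∑ j, k j = N := (Finset.mem_piAntidiag.1 hk).1
      have h7 : digitSum p N = e * (p - 1) := by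
        rw [hN, digitSum_pow_mul hp.out.one_lt, hF, digitSum_pow_sub_one hp.out.one_lt]
      have h8 : ∑ i, digitSum p (r i) ≤ ∑ j, digitSum p (k j) := by
        -- For each i the exponent ∑ q^b k(i,b) reduces to r_i, so its digit sum is at least that of
        -- r_i; by subadditivity it is at most ∑ S_p(k(i,b)), as factors q^b only shift digits.
        rw [Fintype.sum_prod_type]
        refine Finset.sum_le_sum fun i _ => ?_
        rcases Nat.eq_zero_or_pos (r i) with h0 | h0
        · simp [h0, digitSum_zero]
        · have hn := Nat.pos_of_ne_zero (mt (h4 i).1.2 h0.ne')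
          have h9 := digitSum_le_of_modEq hM h0 (hK ▸ hr i) hn (hK ▸ (h4 i).2)
          refine h9.trans ((digitSum_sum_le _ _).trans (le_of_eq ?_))
          refine Finset.sum_congr rfl fun b _ => ?_
          rw [hF, ← pow_mul, digitSum_pow_mul hp.out.one_lt]
      rw [h6, h7] at h5
      rw [hx, ← h5, mul_add, mul_comm e] at h8
      exact Nat.le_of_mul_le_mul_left (Nat.le_of_add_le_add_right h8) hp1
    · simp
  have h3 := coef_add (teich p K) (fun a => z a ^ N - traceInd F K (WittVector p K) ι a)
    (traceInd F K (WittVector p K) ι) r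
  simp only [sub_add_cancel] at h3
  rw [h3] at h2
  exact (dvd_add_right h1).1 h2

/-- Moves coefficients from W(K) to an extension that contains the additive characters needed for
Gauss sums. -/
lemma map_coef_traceInd {R : Type*} [CommRing R] {R' : Type*} [CommRing R'] (φ : R →+* R')
    (T : K →*₀ R) (r : ι → ℕ) :
    φ (coef T (traceInd F K R ι) r) =
      coef (φ.toMonoidWithZeroHom.comp T) (traceInd F K R' ι) r := by
  simp only [coef, map_sum, map_mul, map_prod, map_kern, traceInd, apply_ite φ, map_zero, map_one]

/-- The lower bound for the coefficients of the indicator function, in terms of Gauss sums. -/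
lemma exists_map_pow_mul_eq_prod_gaussCoef {R : Type*} [CommRing R] [IsDomain R]
    (φ : WittVector p K →+* R) (hφ : Function.Injective φ) {e M : ℕ}
    (hF : Fintype.card F = p ^ e) (hK : Fintype.card K = p ^ M) {ψ : AddChar F R} (hψ : ψ ≠ 1)
    {r : ι → ℕ} (hr : ∀ i, r i ≤ Fintype.card K - 1) (hd : Fintype.card F - 1 ∣ ∑ i, r i) {z : ℕ}
    (hz : ∑ i, digitSum p (r i) = (p - 1) * z) :
    ∃ w, φ (p ^ z * w) = ((Fintype.card F : R) - 1) *
      ∏ i, gaussCoef (φ.toMonoidWithZeroHom.comp (teich p K)) (traceChar K ψ) (r i) := by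
  have hp1 : 0 < p - 1 := Nat.sub_pos_of_lt hp.out.one_lt
  have he : 0 < e := pos_of_card_eq_pow hF
  rcases Nat.eq_zero_or_pos (∑ i, r i) with h0 | h0
  -- The zero vector must be included here: it is the complement of the vector with all entries |K|
  -- - 1.
  · have h1 (i) : r i = 0 := by simpa using (Finset.sum_eq_zero_iff.1 h0) i
    have hz0 : z = 0 := by
      have : (p - 1) * z = 0 := by rw [← hz]; simp [h1, digitSum_zero]
      exact (Nat.mul_eq_zero.1 this).resolve_left hp1.ne'
    refine ⟨((Fintype.card F : WittVector p K) - 1) *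
      ((Fintype.card K : WittVector p K) - 1) ^ Fintype.card ι, ?_⟩
    simp [hz0, h1, gaussCoef_zero]
  · obtain ⟨x, hx⟩ := exists_sum_digitSum_eq he h0 (hF ▸ hd)
    obtain rfl : z = x + e := Nat.eq_of_mul_eq_mul_left hp1 (hz.symm.trans hx)
    obtain ⟨c, hc⟩ := pow_dvd_coef_traceInd (F := F) hF hK hr hx
    have h2 := card_mul_coef_traceInd (φ.toMonoidWithZeroHom.comp (teich p K))
      (hφ.comp teich_injective) hψ hr
    rw [if_pos ⟨h0, hd⟩, ← map_coef_traceInd, hc, neg_mul] at h2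
    refine ⟨-c, ?_⟩
    rw [← neg_eq_iff_eq_neg.2 h2]
    simp only [hF, map_mul, map_pow, map_natCast, map_neg, Nat.cast_pow]
    ring

/-- The Witt vectors of `K` embed into a domain that carries a nontrivial additive character
of `F`. -/
lemma exists_embedding_addChar.{u} {p : ℕ} [Fact p.Prime] {K : Type u} [Field K] [CharP K p]
    {F : Type*} [Field F] [Finite F] [Algebra F K] :
    ∃ (E : Type u) (_ : CommRing E) (_ : IsDomain E) (φ : WittVector p K →+* E)
      (ψ : AddChar F E), Function.Injective φ ∧ ψ ≠ 1 := by
  have : CharP F p := by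
    rw [Algebra.charP_iff F K p]
    infer_instance
  let E := FractionRing (WittVector p K)
  -- A primitive character of F exists over a cyclotomic extension of E because p ≠ 0 in E.
  have hchar : ringChar E ≠ ringChar F := by
    rw [ringChar.eq F p]
    intro h
    have h1 := ringChar.Nat.cast_ringChar (R := E)
    rw [h, ← map_natCast (algebraMap (WittVector p K) E), map_eq_zero_iff _
      (IsFractionRing.injective (WittVector p K) E)] at h1
    exact natCast_p_ne_zero h1
  let P := AddChar.FiniteField.primitiveChar F E hchar
  refine ⟨CyclotomicField P.n E, inferInstance, inferInstance,
    (algebraMap E (CyclotomicField P.n E)).comp (algebraMap (WittVector p K) E), P.char,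
    (algebraMap E (CyclotomicField P.n E)).injective.comp
      (IsFractionRing.injective (WittVector p K) E), ?_⟩
  have := P.prim one_ne_zero
  rwa [AddChar.mulShift_one] at this

lemma coef_traceInd_eq_zero {e : ℕ} (hF : Fintype.card F = p ^ e) {r : ι → ℕ}
    (hr : ∀ i, r i ≤ Fintype.card K - 1)
    (h : ¬ (0 < ∑ i, r i ∧ Fintype.card F - 1 ∣ ∑ i, r i)) :
    coef (teich p K) (traceInd F K (WittVector p K) ι) r = 0 := by
  obtain ⟨E, _, _, φ, ψ, hφ, hψ⟩ := exists_embedding_addChar (p := p) (K := K) (F := F)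
  have h2 := card_mul_coef_traceInd (φ.toMonoidWithZeroHom.comp (teich p K))
    (hφ.comp teich_injective) hψ hr
  rw [if_neg h, ← map_coef_traceInd, hF, ← map_natCast φ, ← map_mul, map_eq_zero_iff φ hφ,
    Nat.cast_pow] at h2
  exact (mul_eq_zero.1 h2).resolve_left (pow_ne_zero _ natCast_p_ne_zero)

/-- Upper bound for the `p`-adic valuation of the coefficients of the indicator function. -/
lemma not_pow_succ_dvd_coef_traceInd {e M x : ℕ} (hF : Fintype.card F = p ^ e)
    (hK : Fintype.card K = p ^ M) (hFK : Fintype.card F - 1 ∣ Fintype.card K - 1) {r : ι → ℕ}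
    (hr : ∀ i, r i ≤ Fintype.card K - 1) (h0 : 0 < ∑ i, r i)
    (hd : Fintype.card F - 1 ∣ ∑ i, r i) (hx : ∑ i, digitSum p (r i) = (p - 1) * (x + e)) :
    ¬ (p : WittVector p K) ^ (x + 1) ∣
      coef (teich p K) (traceInd F K (WittVector p K) ι) r := by
  have hp1 : 0 < p - 1 := Nat.sub_pos_of_lt hp.out.one_lt
  have he : 0 < e := pos_of_card_eq_pow hF
  have hM : 0 < M := pos_of_card_eq_pow hK
  obtain ⟨E, _, _, φ, ψ, hφ, hψ⟩ := exists_embedding_addChar (p := p) (K := K) (F := F)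
  set T := φ.toMonoidWithZeroHom.comp (teich p K) with hTdef
  have hT : Function.Injective T := hφ.comp teich_injective
  have hsum : ∑ i, (Fintype.card K - 1 - r i) + ∑ i, r i =
      Fintype.card ι * (Fintype.card K - 1) := by
    rw [← Finset.sum_add_distrib, Finset.sum_congr rfl fun i _ => Nat.sub_add_cancel (hr i)]
    simp
  have hd' : Fintype.card F - 1 ∣ ∑ i, (Fintype.card K - 1 - r i) :=
    (Nat.dvd_add_left hd).1 (hsum ▸ hFK.mul_left _)
  have hdig : ∑ i, digitSum p (r i) + ∑ i, digitSum p (Fintype.card K - 1 - r i) =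
      (p - 1) * (Fintype.card ι * M) := by
    have h1 (i : ι) : digitSum p (r i) + digitSum p (Fintype.card K - 1 - r i) = M * (p - 1) := by
      rw [hK]
      exact digitSum_add_digitSum_compl hp.out.one_lt M (hK ▸ hr i)
    rw [← Finset.sum_add_distrib, Finset.sum_congr rfl fun i _ => h1 i]
    simp only [Finset.sum_const, Finset.card_univ, smul_eq_mul]
    ring
  obtain ⟨z', hz'⟩ : p - 1 ∣ ∑ i, digitSum p (Fintype.card K - 1 - r i) :=
    (Nat.dvd_add_right (hx ▸ dvd_mul_right _ _)).1 (hdig ▸ dvd_mul_right _ _)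
  have hzz : x + e + z' = Fintype.card ι * M := by
    rw [hx, hz', ← mul_add] at hdig
    exact Nat.eq_of_mul_eq_mul_left hp1 hdig
  obtain ⟨w, hw⟩ := exists_map_pow_mul_eq_prod_gaussCoef φ hφ hF hK hψ hr hd hx
  obtain ⟨w', hw'⟩ := exists_map_pow_mul_eq_prod_gaussCoef φ hφ hF hK (inv_ne_one.2 hψ)
    (fun i => Nat.sub_le _ (r i)) hd' hz'
  rw [← hTdef] at hw hw'
  rw [traceChar_inv] at hw'
  have hprod : φ (p ^ (x + e) * w) * φ (p ^ z' * w') =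
      φ (p ^ (Fintype.card ι * M) * (((Fintype.card F : WittVector p K) - 1) ^ 2 *
        ∏ i, if 0 < r i ∧ r i < Fintype.card K - 1 then 1
          else 1 - (Fintype.card K : WittVector p K))) := by
    rw [hw, hw', mul_mul_mul_comm, ← Finset.prod_mul_distrib,
      Finset.prod_congr rfl fun i _ => gaussCoef_mul_gaussCoef T hT (traceChar_ne_one hψ) (hr i),
      Finset.prod_mul_distrib, Finset.prod_const, Finset.card_univ]
    simp only [map_mul, map_prod, apply_ite φ, map_sub, map_one, map_pow, map_natCast]
    rw [show (Fintype.card K : E) ^ Fintype.card ι =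
      (p : E) ^ (Fintype.card ι * M) by rw [hK]; push_cast; ring]
    ring
  rw [← map_mul] at hprod
  -- Cancelling the power of p leaves an element with constant coefficient 1, so w is not divisible
  -- by p.
  have hww : w * w' = ((Fintype.card F : WittVector p K) - 1) ^ 2 *
      ∏ i, if 0 < r i ∧ r i < Fintype.card K - 1 then 1
        else 1 - (Fintype.card K : WittVector p K) := by
    refine mul_left_cancel₀ (pow_ne_zero (Fintype.card ι * M) natCast_p_ne_zero) ?_
    rw [← hφ hprod, ← hzz]
    ring
  rintro ⟨c, hc⟩
  have h2 := card_mul_coef_traceInd T hT hψ hr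
  rw [if_pos ⟨h0, hd⟩, neg_mul, ← hw, hTdef, ← map_coef_traceInd, hc, hF, ← map_natCast φ,
    ← map_mul, ← map_neg] at h2
  -- One more factor p in the coefficient would make w divisible by p.
  have h3 : w = p * -c := by
    refine mul_left_cancel₀ (pow_ne_zero (x + e) natCast_p_ne_zero) ?_
    rw [← neg_eq_iff_eq_neg.2 (hφ h2)]
    push_cast
    ring
  have h4 := congrArg WittVector.constantCoeff hww
  rw [h3] at h4
  have hF0 : (Fintype.card F : K) = 0 := by rw [hF]; simp [he.ne']
  have hK0 : (Fintype.card K : K) = 0 := by rw [hK]; simp [hM.ne']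
  simp only [map_mul, map_pow, map_sub, map_one, map_prod, apply_ite WittVector.constantCoeff,
    map_natCast, CharP.cast_eq_zero, zero_mul, hF0, hK0] at h4
  simp at h4

end Witt

/-! ### Orthogonality of the characters of the group. -/

section Characters

variable {h : ℕ} {n : Fin h → ℕ} [∀ ℓ, NeZero (n ℓ)] {R : Type*} [CommRing R]

lemma sum_zmod_pow_val [IsDomain R] [DecidableEq R] {d : ℕ} [NeZero d] {x : R} (hx : x ^ d = 1) :
    ∑ j : ZMod d, x ^ j.val = if x = 1 then (d : R) else 0 := by
  have h1 : ∑ j : ZMod d, x ^ j.val = ∑ i ∈ Finset.range d, x ^ i := by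
    obtain ⟨d, rfl⟩ := Nat.exists_eq_succ_of_ne_zero (NeZero.ne d)
    exact Fin.sum_univ_eq_sum_range (fun i => x ^ i) (d + 1)
  rw [h1]
  split_ifs with h2
  · simp [h2]
  · have h3 := geom_sum_mul x d
    rw [hx, sub_self, mul_eq_zero] at h3
    exact h3.resolve_right (sub_ne_zero.2 h2)

/-- The character `j ↦ ∏ ℓ, γ_ℓ ^ (s_ℓ j_ℓ)` of `ℤ/n₁ × ⋯ × ℤ/n_h`. -/
def chi (γ : Fin h → R) (s j : Grp n) : R := ∏ ℓ, γ ℓ ^ ((s ℓ).val * (j ℓ).val)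

lemma sum_prod_pow_mul_val [IsDomain R] {γ : Fin h → R} (hγ : ∀ ℓ, IsPrimitiveRoot (γ ℓ) (n ℓ))
    (v : Fin h → ℕ) :
    ∑ j : Grp n, ∏ ℓ, γ ℓ ^ (v ℓ * (j ℓ).val) =
      if ∀ ℓ, n ℓ ∣ v ℓ then ∏ ℓ, (n ℓ : R) else 0 := by
  have h1 := Finset.prod_univ_sum (fun ℓ => (Finset.univ : Finset (ZMod (n ℓ))))
    (fun ℓ j => γ ℓ ^ (v ℓ * j.val))
  rw [Fintype.piFinset_univ] at h1
  rw [← h1]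
  have h2 (ℓ) : ∑ j : ZMod (n ℓ), γ ℓ ^ (v ℓ * j.val) = if n ℓ ∣ v ℓ then (n ℓ : R) else 0 := by
    classical
    simp only [pow_mul]
    rw [sum_zmod_pow_val (by rw [← pow_mul, mul_comm, pow_mul, (hγ ℓ).pow_eq_one, one_pow])]
    exact if_congr ((hγ ℓ).pow_eq_one_iff_dvd _) rfl rfl
  simp only [h2]
  split_ifs with h3
  · exact Finset.prod_congr rfl fun ℓ _ => if_pos (h3 ℓ)
  · push Not at h3
    obtain ⟨ℓ, hℓ⟩ := h3
    exact Finset.prod_eq_zero (Finset.mem_univ ℓ) (if_neg hℓ)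

lemma chi_add {γ : Fin h → R} (hγ : ∀ ℓ, γ ℓ ^ n ℓ = 1) (s j j' : Grp n) :
    chi γ s (j + j') = chi γ s j * chi γ s j' := by
  simp only [chi, ← Finset.prod_mul_distrib]
  refine Finset.prod_congr rfl fun ℓ _ => ?_
  rw [← pow_add, ← mul_add, Pi.add_apply, ZMod.val_add, mul_comm, mul_comm _ (_ + _), pow_mul,
    pow_mul, ← pow_eq_pow_mod _ (hγ ℓ)]

lemma sum_chi [IsDomain R] {γ : Fin h → R} (hγ : ∀ ℓ, IsPrimitiveRoot (γ ℓ) (n ℓ)) (j : Grp n) :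
    ∑ s, chi γ s j = if j = 0 then ∏ ℓ, (n ℓ : R) else 0 := by
  have h1 (s : Grp n) : chi γ s j = ∏ ℓ, γ ℓ ^ ((j ℓ).val * (s ℓ).val) :=
    Finset.prod_congr rfl fun ℓ _ => by rw [mul_comm]
  simp only [h1]
  rw [sum_prod_pow_mul_val hγ fun ℓ => (j ℓ).val]
  refine if_congr ?_ rfl rfl
  rw [funext_iff]
  refine forall_congr' fun ℓ => ?_
  rw [← ZMod.natCast_eq_zero_iff, ZMod.natCast_zmod_val, Pi.zero_apply]

end Characters

/-! ### Trace description of ideals by Fourier inversion. -/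

section Structure

variable {F K : Type*} [Field F] [Field K] [Algebra F K] {h : ℕ} {n : Fin h → ℕ}
  [∀ ℓ, NeZero (n ℓ)]

/-- The word with prescribed coefficients. -/
noncomputable def word (f : Grp n → F) : AddMonoidAlgebra F (Grp n) :=
  .ofCoeff (Finsupp.equivFunOnFinite.symm f)

lemma coeff_word (f : Grp n → F) (j : Grp n) : (word f).coeff j = f j := rfl

/-- The value at the character `-s` of the Fourier transform of `c`. -/
noncomputable def fourier (γ : Fin h → K) (c : AddMonoidAlgebra F (Grp n)) (s : Grp n) : K :=
  ∑ u, algebraMap F K (c.coeff u) * chi γ s (-u)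

lemma sum_fourier_mul_chi {γ : Fin h → K} (hγ : ∀ ℓ, IsPrimitiveRoot (γ ℓ) (n ℓ))
    (c : AddMonoidAlgebra F (Grp n)) (j : Grp n) :
    ∑ s, fourier γ c s * chi γ s j = (∏ ℓ, (n ℓ : K)) * algebraMap F K (c.coeff j) := by
  simp only [fourier, Finset.sum_mul, mul_assoc, ← chi_add fun ℓ => (hγ ℓ).pow_eq_one]
  rw [Finset.sum_comm]
  simp only [← Finset.mul_sum, sum_chi hγ, neg_add_eq_zero, mul_ite, mul_zero]
  rw [Finset.sum_ite_eq' Finset.univ j]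
  simp [mul_comm]

/-- Multiplication in the group algebra is convolution, so c acts on the words Tr(β χ_s) by scaling
β with its transform at s. -/
lemma coeff_mul_word_trace {γ : Fin h → K} (hγ : ∀ ℓ, γ ℓ ^ n ℓ = 1)
    (c : AddMonoidAlgebra F (Grp n)) (s j : Grp n) (β : K) :
    (c * word fun j => Algebra.trace F K (β * chi γ s j)).coeff j =
      Algebra.trace F K (β * fourier γ c s * chi γ s j) := by
  rw [AddMonoidAlgebra.coeff_mul_apply_left, Finsupp.sum_fintype _ _ (by simp)]
  simp only [coeff_word, chi_add hγ, fourier, Finset.mul_sum, Finset.sum_mul, map_sum]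
  refine Finset.sum_congr rfl fun u _ => ?_
  rw [← smul_eq_mul (c.coeff u), ← map_smul, Algebra.smul_def]
  congr 1
  ring

theorem exists_isTraceCodeOf [Finite K] {γ : Fin h → K}
    (hγ : ∀ ℓ, IsPrimitiveRoot (γ ℓ) (n ℓ)) (hA : ∏ ℓ, (n ℓ : K) ≠ 0)
    (C : Ideal (AddMonoidAlgebra F (Grp n))) :
    ∃ (k : ℕ) (s : Fin k → Grp n), Function.Injective s ∧
      IsTraceCodeOf (C : Set (AddMonoidAlgebra F (Grp n))) (expMatrix γ s) := by
  classical
  have hγ1 (ℓ) : γ ℓ ^ n ℓ = 1 := (hγ ℓ).pow_eq_one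
  have : Finite F := Finite.of_injective _ (algebraMap F K).injective
  have : FiniteDimensional F K := Module.Finite.of_finite
  let S : Finset (Grp n) := {s | ∃ c ∈ C, fourier γ c s ≠ 0}
  let s : Fin S.card → Grp n := fun i => (S.equivFin.symm i : Grp n)
  refine ⟨S.card, s, Subtype.val_injective.comp S.equivFin.symm.injective, fun c => ⟨?_, ?_⟩⟩
  · intro hc
    -- With Tr β = 1, the trace of β x is x for x in F; this puts the trace in front of the
    -- inversion formula.
    obtain ⟨β, hβ⟩ := Algebra.trace_surjective F K 1
    refine ⟨fun i => β / (∏ ℓ, (n ℓ : K)) * fourier γ c (s i), fun j => ?_⟩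
    have h1 : ∑ i, β / (∏ ℓ, (n ℓ : K)) * fourier γ c (s i) * expMatrix γ s i j =
        β / (∏ ℓ, (n ℓ : K)) * ∑ s, fourier γ c s * chi γ s j := by
      rw [Finset.mul_sum, ← Finset.sum_subset (Finset.subset_univ S), ← Finset.sum_coe_sort S,
        ← S.equivFin.symm.sum_comp]
      · exact Finset.sum_congr rfl fun i _ => mul_assoc _ _ _
      · intro s _ hs
        have : fourier γ c s = 0 := by
          by_contra h0
          exact hs (by simpa [S] using ⟨c, hc, h0⟩)
        simp [this]
    rw [h1, sum_fourier_mul_chi hγ, ← mul_assoc, div_mul_cancel₀ _ hA, mul_comm,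
      ← Algebra.smul_def, map_smul, hβ, smul_eq_mul, mul_one]
  · rintro ⟨α, hα⟩
    have h1 : c = ∑ i, word fun j => Algebra.trace F K (α i * chi γ (s i) j) := by
      refine AddMonoidAlgebra.coeff_injective (Finsupp.ext fun j => ?_)
      rw [hα j, AddMonoidAlgebra.coeff_sum, Finsupp.finsetSum_apply, map_sum]
      rfl
    rw [h1]
    refine C.sum_mem fun i _ => ?_
    obtain ⟨c₀, hc₀, h0⟩ : ∃ c ∈ C, fourier γ c (s i) ≠ 0 := by
      have : s i ∈ S := (S.equivFin.symm i).2
      simpa [S] using this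
    -- The transform of c₀ at s i is invertible in K, so a multiple of c₀ produces any prescribed
    -- coefficient α i.
    have h2 : (word fun j => Algebra.trace F K (α i * chi γ (s i) j)) =
        c₀ * word fun j => Algebra.trace F K (α i / fourier γ c₀ (s i) * chi γ (s i) j) := by
      refine AddMonoidAlgebra.coeff_injective (Finsupp.ext fun j => ?_)
      rw [coeff_mul_word_trace hγ1, div_mul_cancel₀ _ h0, coeff_word]
    rw [h2]
    exact C.mul_mem_right _ hc₀

end Structure

/-! ### Expansion of the weight function and the valuation of the code. -/

section Weights

set_option linter.unusedSectionVars false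

variable {p : ℕ} [hp : Fact p.Prime] {K : Type*} [Field K] [CharP K p] [Fintype K] [DecidableEq K]
  {F : Type*} [Field F] [Fintype F] [DecidableEq F] [Algebra F K]
  {h k : ℕ} {n : Fin h → ℕ} [∀ ℓ, NeZero (n ℓ)]

/-- The codeword attached to `α`. -/
noncomputable def codeword (F : Type*) [Field F] [Algebra F K] (γ : Fin h → K)
    (s : Fin k → Grp n) (α : Fin k → K) : AddMonoidAlgebra F (Grp n) :=
  word fun j => Algebra.trace F K (∑ i, α i * expMatrix γ s i j)

lemma weight_codeword (γ : Fin h → K) (s : Fin k → Grp n) (α : Fin k → K) :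
    (weight (codeword F γ s α) : WittVector p K) =
      ∑ j, traceInd F K (WittVector p K) (Fin k) fun i => α i * expMatrix γ s i j := by
  have h1 : (codeword F γ s α).coeff.support =
      Finset.univ.filter fun j => Algebra.trace F K (∑ i, α i * expMatrix γ s i j) ≠ 0 := by
    ext j
    rw [Finsupp.mem_support_iff, Finset.mem_filter_univ]
    rfl
  rw [weight, h1, Finset.card_filter, Nat.cast_sum]
  refine Finset.sum_congr rfl fun j _ => ?_
  rw [traceInd]
  split_ifs <;> simp_all

lemma sum_prod_teich_expMatrix_pow {γ : Fin h → K} (hγ : ∀ ℓ, IsPrimitiveRoot (γ ℓ) (n ℓ))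
    (s : Fin k → Grp n) (r : Fin k → ℕ) :
    ∑ j, ∏ i, teich p K (expMatrix γ s i j) ^ r i =
      if ∀ ℓ, n ℓ ∣ ∑ i, r i * (s i ℓ).val then ∏ ℓ, (n ℓ : WittVector p K) else 0 := by
  rw [← sum_prod_pow_mul_val (γ := fun ℓ => teich p K (γ ℓ))
    fun ℓ => (hγ ℓ).map_of_injective teich_injective]
  refine Finset.sum_congr rfl fun j _ => ?_
  simp only [expMatrix, map_prod, map_pow, ← Finset.prod_pow, Finset.sum_mul]
  rw [Finset.prod_comm]
  refine Finset.prod_congr rfl fun ℓ _ => ?_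
  rw [← Finset.prod_pow_eq_pow_sum]
  refine Finset.prod_congr rfl fun i _ => ?_
  rw [← pow_mul]
  congr 1
  ring

/-- The expansion of the weight function into monomials. -/
lemma mul_weight_codeword {γ : Fin h → K} (hγ : ∀ ℓ, IsPrimitiveRoot (γ ℓ) (n ℓ))
    (s : Fin k → Grp n) (α : Fin k → K) :
    ((Fintype.card K : WittVector p K) - 1) ^ k * (weight (codeword F γ s α) : WittVector p K) =
      ∑ r ∈ Fintype.piFinset (fun _ : Fin k => Finset.range (Fintype.card K)),
        (coef (teich p K) (traceInd F K (WittVector p K) (Fin k)) r *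
          if ∀ ℓ, n ℓ ∣ ∑ i, r i * (s i ℓ).val then ∏ ℓ, (n ℓ : WittVector p K) else 0) *
        ∏ i, teich p K (α i) ^ r i := by
  have h1 (j : Grp n) := sum_coef_mul_prod_pow (teich p K) teich_injective
    (traceInd F K (WittVector p K) (Fin k)) fun i => α i * expMatrix γ s i j
  rw [Fintype.card_fin] at h1
  rw [weight_codeword, Finset.mul_sum, Finset.sum_congr rfl fun j _ => (h1 j).symm,
    Finset.sum_comm]
  refine Finset.sum_congr rfl fun r _ => ?_
  simp only [map_mul, mul_pow, Finset.prod_mul_distrib, ← mul_assoc, ← Finset.mul_sum,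
    sum_prod_teich_expMatrix_pow hγ]
  ring

/-- The coefficients of the weight function. -/
lemma coef_mul_weight_codeword {γ : Fin h → K} (hγ : ∀ ℓ, IsPrimitiveRoot (γ ℓ) (n ℓ))
    (s : Fin k → Grp n) {r : Fin k → ℕ} (hr : ∀ i, r i ≤ Fintype.card K - 1)
    (hs : ∀ ℓ, n ℓ ∣ ∑ i, r i * (s i ℓ).val) :
    coef (teich p K) (fun α => ((Fintype.card K : WittVector p K) - 1) ^ k *
      (weight (codeword F γ s α) : WittVector p K)) r =
      coef (teich p K) (traceInd F K (WittVector p K) (Fin k)) r *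
        ((∏ ℓ, (n ℓ : WittVector p K)) * ((Fintype.card K : WittVector p K) - 1) ^ k) := by
  have hQ : 1 < Fintype.card K := Fintype.one_lt_card
  simp only [mul_weight_codeword hγ]
  rw [coef_sum]
  simp only [coef_const_mul, coef_prod_pow _ teich_injective hr, Fintype.card_fin]
  rw [Finset.sum_eq_single r]
  · rw [if_pos hs, if_pos fun i => ⟨Iff.rfl, rfl⟩, mul_assoc]
  · intro r' hr' hne
    refine mul_eq_zero_of_right _ (if_neg fun hred => ?_)
    refine hne (funext fun i => ?_)
    have h1 : r' i < Fintype.card K := Finset.mem_range.1 (Fintype.mem_piFinset.1 hr' i)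
    have h2 := hr i
    obtain ⟨h3, h4⟩ := hred i
    rcases Nat.eq_zero_or_pos (r i) with h0 | h0
    · rw [h0, h3.1 h0]
    · have h0' : 0 < r' i := Nat.pos_of_ne_zero (mt h3.2 h0.ne')
      -- Positive exponents lie in [1, |K| - 1]; shifting by 1 gives residues below the modulus |K|
      -- - 1.
      have h5 : r' i - 1 ≡ r i - 1 [MOD Fintype.card K - 1] := by
        refine Nat.ModEq.add_right_cancel' 1 ?_
        rwa [Nat.sub_add_cancel h0', Nat.sub_add_cancel h0]
      have := Nat.ModEq.eq_of_lt_of_lt h5 (by omega) (by omega)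
      omega
  · intro hr'
    refine absurd (Fintype.mem_piFinset.2 fun i => Finset.mem_range.2 ?_) hr'
    have := hr i
    omega

lemma isUnit_of_constantCoeff_ne_zero {u : WittVector p K}
    (hu : WittVector.constantCoeff u ≠ 0) : IsUnit u :=
  WittVector.isUnit_of_coeff_zero_ne_zero u hu

lemma isUnit_card_sub_one : IsUnit ((Fintype.card K : WittVector p K) - 1) := by
  refine isUnit_of_constantCoeff_ne_zero ?_
  rw [map_sub, map_natCast, map_one, FiniteField.cast_card_eq_zero]
  simp

lemma pow_dvd_weight_codeword {e M t : ℕ} (hF : Fintype.card F = p ^ e)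
    (hK : Fintype.card K = p ^ M) {γ : Fin h → K} (hγ : ∀ ℓ, IsPrimitiveRoot (γ ℓ) (n ℓ))
    (s : Fin k → Grp n)
    (ht : ∀ r ∈ feasible (Fintype.card F) (Fintype.card K) s, ∀ x,
      ∑ i, digitSum p (r i) = (p - 1) * (x + e) → t ≤ x) (α : Fin k → K) :
    p ^ t ∣ weight (codeword F γ s α) := by
  have he : 0 < e := pos_of_card_eq_pow hF
  rw [← pow_dvd_natCast_iff (K := K), ← (isUnit_card_sub_one.pow k).dvd_mul_left,
    mul_weight_codeword hγ]
  refine Finset.dvd_sum fun r hr => Dvd.dvd.mul_right ?_ _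
  have hr' (i) : r i ≤ Fintype.card K - 1 :=
    Nat.le_sub_one_of_lt (Finset.mem_range.1 (Fintype.mem_piFinset.1 hr i))
  split_ifs with hs
  · refine Dvd.dvd.mul_right ?_ _
    by_cases h0 : 0 < ∑ i, r i ∧ Fintype.card F - 1 ∣ ∑ i, r i
    · obtain ⟨x, hx⟩ := exists_sum_digitSum_eq he h0.1 (hF ▸ h0.2)
      refine (pow_dvd_pow _ (ht r ⟨hr', h0.1, (Nat.modEq_zero_iff_dvd).2 h0.2, fun ℓ =>
        (Nat.modEq_zero_iff_dvd).2 (hs ℓ)⟩ x hx)).trans (pow_dvd_coef_traceInd hF hK hr' hx)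
    · rw [coef_traceInd_eq_zero hF hr' h0]
      exact dvd_zero _
  · simp

lemma exists_not_pow_succ_dvd_weight_codeword {e M x : ℕ} (hF : Fintype.card F = p ^ e)
    (hK : Fintype.card K = p ^ M) (hFK : Fintype.card F - 1 ∣ Fintype.card K - 1)
    {γ : Fin h → K} (hγ : ∀ ℓ, IsPrimitiveRoot (γ ℓ) (n ℓ)) (hA : ∏ ℓ, (n ℓ : K) ≠ 0)
    (s : Fin k → Grp n) {r : Fin k → ℕ}
    (hr : r ∈ feasible (Fintype.card F) (Fintype.card K) s)
    (hx : ∑ i, digitSum p (r i) = (p - 1) * (x + e)) :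
    ∃ α, ¬ p ^ (x + 1) ∣ weight (codeword F γ s α) := by
  by_contra! hall
  obtain ⟨hr1, h0, hd, hs⟩ := hr
  refine not_pow_succ_dvd_coef_traceInd hF hK hFK hr1 h0 ((Nat.modEq_zero_iff_dvd).1 hd) hx ?_
  have h1 := coef_mul_weight_codeword (p := p) (F := F) hγ s hr1
    fun ℓ => (Nat.modEq_zero_iff_dvd).1 (hs ℓ)
  have h2 : IsUnit ((∏ ℓ, (n ℓ : WittVector p K)) *
      ((Fintype.card K : WittVector p K) - 1) ^ k) := by
    refine IsUnit.mul (isUnit_of_constantCoeff_ne_zero ?_) (isUnit_card_sub_one.pow k)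
    simpa only [map_prod, map_natCast] using hA
  rw [← h2.dvd_mul_right, ← h1]
  exact dvd_coef _ (fun α => ((pow_dvd_natCast_iff _ _).2 (hall α)).mul_left _) r

lemma objective_eq {e x : ℕ} {r : Fin k → ℕ}
    (hx : ∑ i, digitSum p (r i) = (p - 1) * (x + e)) : objective p e r = x := by
  have hp1 : (p : ℚ) - 1 ≠ 0 := by
    have : (1 : ℚ) < p := by exact_mod_cast hp.out.one_lt
    linarith
  rw [objective, hx]
  push_cast [Nat.cast_sub hp.out.one_lt.le]
  field_simp
  ring

/-- The valuation of a nonzero abelian code given by its trace description. -/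
theorem exists_isPadicValuation {e M : ℕ} (hF : Fintype.card F = p ^ e)
    (hK : Fintype.card K = p ^ M) (hFK : Fintype.card F - 1 ∣ Fintype.card K - 1)
    {γ : Fin h → K} (hγ : ∀ ℓ, IsPrimitiveRoot (γ ℓ) (n ℓ)) (hA : ∏ ℓ, (n ℓ : K) ≠ 0)
    {s : Fin k → Grp n} {C : Set (AddMonoidAlgebra F (Grp n))}
    (hC : IsTraceCodeOf C (expMatrix γ s)) (hk : 0 < k) :
    ∃ t : ℕ, IsPadicValuation p C t ∧
      IsLeast (objective p e '' feasible (Fintype.card F) (Fintype.card K) s) (t : ℚ) := by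
  classical
  have hQ : 1 < Fintype.card K := Fintype.one_lt_card
  have he : 0 < e := pos_of_card_eq_pow hF
  have hint (r) (hr : r ∈ feasible (Fintype.card F) (Fintype.card K) s) :
      ∃ x, ∑ i, digitSum p (r i) = (p - 1) * (x + e) :=
    exists_sum_digitSum_eq he hr.2.1 (hF ▸ (Nat.modEq_zero_iff_dvd).1 hr.2.2.1)
  -- This vector shows that the minimum is over a nonempty set: each n_ℓ divides |K| - 1, and k > 0
  -- makes it nonzero.
  have hne : (fun _ => Fintype.card K - 1) ∈ feasible (Fintype.card F) (Fintype.card K) s := by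
    refine ⟨fun _ => le_rfl, ?_, ?_, fun ℓ => ?_⟩
    · rw [Finset.sum_const, Finset.card_univ, Fintype.card_fin, smul_eq_mul]
      exact Nat.mul_pos hk (by omega)
    · exact (Nat.modEq_zero_iff_dvd).2 (Finset.dvd_sum fun _ _ => hFK)
    · refine (Nat.modEq_zero_iff_dvd).2 (Finset.dvd_sum fun i _ => Dvd.dvd.mul_right ?_ _)
      refine (hγ ℓ).dvd_of_pow_eq_one _ (FiniteField.pow_card_sub_one_eq_one _ ?_)
      exact (hγ ℓ).ne_zero (NeZero.ne _)
  have hex : ∃ x, ∃ r ∈ feasible (Fintype.card F) (Fintype.card K) s,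
      ∑ i, digitSum p (r i) = (p - 1) * (x + e) := by
    obtain ⟨x, hx⟩ := hint _ hne
    exact ⟨x, _, hne, hx⟩
  obtain ⟨r, hr, hx⟩ := Nat.find_spec hex
  have hmin (r) (hr : r ∈ feasible (Fintype.card F) (Fintype.card K) s) (x)
      (hx : ∑ i, digitSum p (r i) = (p - 1) * (x + e)) : Nat.find hex ≤ x :=
    Nat.find_min' hex ⟨r, hr, hx⟩
  refine ⟨Nat.find hex, ⟨fun c hc => ?_, fun u hu => ?_⟩, ⟨⟨r, hr, objective_eq hx⟩, ?_⟩⟩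
  · obtain ⟨α, hα⟩ := (hC c).1 hc
    obtain rfl : c = codeword F γ s α :=
      AddMonoidAlgebra.coeff_injective (Finsupp.ext fun j => hα j)
    exact pow_dvd_weight_codeword hF hK hγ s hmin α
  · by_contra! hlt
    obtain ⟨α, hα⟩ := exists_not_pow_succ_dvd_weight_codeword hF hK hFK hγ hA s hr hx
    exact hα ((pow_dvd_pow p hlt).trans (hu _ ((hC _).2 ⟨α, fun j => rfl⟩)))
  · rintro _ ⟨r', hr', rfl⟩
    obtain ⟨x, hx'⟩ := hint r' hr'
    rw [objective_eq hx']
    exact_mod_cast hmin r' hr' x hx'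

end Weights

end AbelianCode

/-! ### The main theorem. -/

theorem mainTheorem4 {F K : Type*} [Field F] [Finite F] [Field K] [Algebra F K]
    (p e q : ℕ) (hp : p.Prime) (hq : q = p ^ e) (hF : Nat.card F = q)
    {h : ℕ} (n : Fin h → ℕ) (hn : ∀ ℓ, 0 < n ℓ)
    (N : ℕ) (hN : N = AddMonoid.exponent (AbelianCode.Grp n)) (hNq : Nat.Coprime N q)
    (m : ℕ) (hm : m = orderOf (q : ZMod N)) (hK : Module.finrank F K = m)
    (γ : Fin h → K) (hγ : ∀ ℓ, IsPrimitiveRoot (γ ℓ) (n ℓ))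
    (C : Ideal (AddMonoidAlgebra F (AbelianCode.Grp n))) :
    (∃ (k : ℕ) (s : Fin k → AbelianCode.Grp n), Function.Injective s ∧
      AbelianCode.IsTraceCodeOf (C : Set (AddMonoidAlgebra F (AbelianCode.Grp n)))
        (AbelianCode.expMatrix γ s)) ∧
    ∀ (k : ℕ) (s : Fin k → AbelianCode.Grp n),
      AbelianCode.IsTraceCodeOf (C : Set (AddMonoidAlgebra F (AbelianCode.Grp n)))
        (AbelianCode.expMatrix γ s) →
      C ≠ ⊥ →
      ∃ t : ℕ,
        AbelianCode.IsPadicValuation p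
          (C : Set (AddMonoidAlgebra F (AbelianCode.Grp n))) t ∧
        IsLeast (AbelianCode.objective p e '' AbelianCode.feasible q (q ^ m) s) (t : ℚ) := by
  classical
  have : Fact p.Prime := ⟨hp⟩
  have (ℓ : Fin h) : NeZero (n ℓ) := ⟨(hn ℓ).ne'⟩
  have := Fintype.ofFinite F
  rw [Nat.card_eq_fintype_card] at hF
  have hN0 : N ≠ 0 := hN ▸ AddMonoid.exponent_ne_zero_of_finite
  have : NeZero N := ⟨hN0⟩
  -- As q is a unit modulo N, its order is positive; a positive `finrank` then forces K to be finite
  -- over F.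
  have hm0 : 0 < m := by
    rw [hm, ← ZMod.coe_unitOfCoprime q hNq.symm, orderOf_units]
    exact orderOf_pos _
  have : FiniteDimensional F K := Module.finite_of_finrank_pos (hK ▸ hm0)
  have : Finite K := Module.finite_of_finite F
  have := Fintype.ofFinite K
  have : CharP F p := charP_of_card_eq_prime_pow (f := e) (by rw [hF, hq])
  have : CharP K p := charP_of_injective_algebraMap (algebraMap F K).injective p
  have hcK : Fintype.card K = q ^ m := by
    rw [Module.card_eq_pow_finrank (K := F), hF, hK]
  have he : e ≠ 0 := (AbelianCode.pos_of_card_eq_pow (hF.trans hq)).ne'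
  -- Each n_ℓ divides the exponent N, which is prime to p.
  have hA : ∏ ℓ, (n ℓ : K) ≠ 0 := by
    refine Finset.prod_ne_zero_iff.2 fun ℓ _ h0 => ?_
    rw [CharP.cast_eq_zero_iff K p] at h0
    have hnN : n ℓ ∣ N := by
      have h1 := congrFun (AddMonoid.exponent_nsmul_eq_zero (1 : AbelianCode.Grp n)) ℓ
      rw [← hN] at h1
      rw [← ZMod.natCast_eq_zero_iff]
      simpa using h1
    have h2 : p ∣ q := hq ▸ dvd_pow_self p he
    exact hp.one_lt.ne' (Nat.dvd_one.1 (hNq ▸ Nat.dvd_gcd (h0.trans hnN) h2))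
  refine ⟨AbelianCode.exists_isTraceCodeOf hγ hA C, fun k s hC hC0 => ?_⟩
  have hk : 0 < k := by
    rcases Nat.eq_zero_or_pos k with rfl | hk
    · refine absurd ((Submodule.eq_bot_iff C).2 fun c hc => ?_) hC0
      obtain ⟨α, hα⟩ := (hC c).1 hc
      exact AddMonoidAlgebra.coeff_injective (Finsupp.ext fun j => by simp [hα j])
    · exact hk
  rw [← hcK, ← hF]
  refine AbelianCode.exists_isPadicValuation (M := e * m) (by rw [hF, hq])
    (by rw [hcK, hq, pow_mul]) ?_ hγ hA hC hk
  rw [hcK, hF]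
  simpa using Nat.sub_dvd_pow_sub_pow q 1 m
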